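/- Let $d\geq 2$, let $a=(a_1,\dots,a_d)\in\mathbb{R}^d$ be a vector all of whose coordinates are non-zero, and let $b\in\mathbb{R}$. Consider the hyperplane $H=\{x\in\mathbb{R}^d : a\cdot x=b\}$. For a point $x\in\mathbb{R}^d$, denote by $\sigma(x)=\sum_{i=1}^d x_i$ the sum of its coordinates and by $\pi(x)=\prod_{i=1}^d x_i$ their product, and let $\|a\|$ be the Euclidean norm of $a$. Then the $(d-1)$-dimensional volume of $H\cap[0,1]^d$ is $$ \sum_{v}\frac{(-1)^{\sigma(v)}\,\|a\|\,(b-a\cdot v)^{d-1}}{(d-1)!\,\pi(a)}, $$ where the sum is over the vertices $v\in\{0,1\}^d$ of $[0,1]^d$ such that $a\cdot v\leq b$. -/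

import Mathlib

open scoped MeasureTheory

namespace HypercubeSection

/-- The sum `σ(x)` of the coordinates of a point. -/
noncomputable def coordSum {d : ℕ} (x : EuclideanSpace ℝ (Fin d)) : ℝ := ∑ i, x i

/-- The product `π(x)` of the coordinates of a point. -/
noncomputable def coordProd {d : ℕ} (x : EuclideanSpace ℝ (Fin d)) : ℝ := ∏ i, x i

/-- The hypercube `[0,1]^d`. -/
def hypercube (d : ℕ) : Set (EuclideanSpace ℝ (Fin d)) :=
  {x | ∀ i, x i ∈ Set.Icc (0 : ℝ) 1}

/-- The hyperplane made up of the points `x` such that `a · x = b`. -/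
def hyperplane {d : ℕ} (a : EuclideanSpace ℝ (Fin d)) (b : ℝ) :
    Set (EuclideanSpace ℝ (Fin d)) :=
  {x | inner ℝ a x = b}

/-- The vertices of the hypercube `[0,1]^d`: the points all of whose coordinates are `0` or `1`. -/
noncomputable def hypercubeVertices (d : ℕ) : Finset (EuclideanSpace ℝ (Fin d)) :=
  (Fintype.piFinset fun _ : Fin d => ({0, 1} : Finset ℝ)).map
    (WithLp.equiv 2 (Fin d → ℝ)).symm.toEmbedding

theorem mem_hypercubeVertices {d : ℕ} (v : EuclideanSpace ℝ (Fin d)) :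
    v ∈ hypercubeVertices d ↔ ∀ i, v i = 0 ∨ v i = 1 := by
  simp only [hypercubeVertices, Finset.mem_map_equiv, Fintype.mem_piFinset, Finset.mem_insert,
    Finset.mem_singleton]
  rfl

/-- At a vertex `v`, the real power `(-1) ^ σ(v)` is the usual sign, given by the parity of the
number of coordinates equal to `1`. -/
theorem neg_one_rpow_coordSum {d : ℕ} {v : EuclideanSpace ℝ (Fin d)}
    (hv : v ∈ hypercubeVertices d) :
    (-1 : ℝ) ^ coordSum v = (-1 : ℝ) ^ (Finset.univ.filter fun i => v i = 1).card := by
  have h : coordSum v = ((Finset.univ.filter fun i => v i = 1).card : ℝ) := by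
    rw [mem_hypercubeVertices] at hv
    rw [coordSum, Finset.card_filter, Nat.cast_sum]
    refine Finset.sum_congr rfl fun i _ => ?_
    rcases hv i with h | h <;> simp [h]
  rw [h, Real.rpow_natCast]

end HypercubeSection

/-!
The section `H ∩ [0,1]^d` is projected along the first coordinate axis, and the volume of the
projection is computed by integrating truncated powers.

With `d = n + 1`, the hyperplane is the graph of an affine function of the last `n` coordinates,
because `a 0 ≠ 0`. The Gram matrix of the linear part of this parametrization is `1 + u uᵀ` with
`u = (a 1, …, a n) / a 0`, so the parametrization multiplies volumes by
`√(1 + ‖u‖²) = ‖a‖ / |a 0|` (`normDet_graphMap`, `volume_section`). The projection of the section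
is the part of `[0,1]^n` in which `∑ i, a i.succ * y i` lies between `b - a 0` and `b`, a slab
whose volume is a difference of volumes of cubes truncated by half-spaces
(`volume_real_projection`).

The volume of `{y ∈ [0,1]^n : a · y ≤ t}` is `∑ v, (-1) ^ σ(v) (t - a · v)₊ ^ n / (n! π(a))`, the
sum being over the vertices of `[0,1]^n` (`volume_real_cubeHalfspace`). This goes by induction on
`n`: slicing along the first coordinate integrates the formula in dimension `n` at `t - a 0 * x`
over `x ∈ [0,1]`. Since `u₊ ^ (n + 1) / (n + 1)` is an antiderivative of `u₊ ^ n`, the result is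
the difference of the values at `t` and at `t - a 0` (`integral_vertexSum`), and this difference
is the sum over the vertices of `[0,1]^(n+1)` (`vertexSum_succ`). The same identity turns the
volume of the slab into a sum over the vertices of `[0,1]^d`.
-/

namespace HypercubeSection

open MeasureTheory
open scoped Pointwise

/-! ### Truncated powers -/

/-- The truncated power `u ↦ u₊ ^ m`, where `u₊ ^ 0` is the indicator function of `[0, ∞)`. -/
noncomputable def truncPow (m : ℕ) (u : ℝ) : ℝ := if 0 ≤ u then u ^ m else 0

theorem truncPow_nonneg (m : ℕ) (u : ℝ) : 0 ≤ truncPow m u := by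
  unfold truncPow
  split_ifs with h <;> positivity

theorem monotone_truncPow (m : ℕ) : Monotone (truncPow m) := by
  intro u v huv
  by_cases hu : 0 ≤ u
  · simp only [truncPow, if_pos hu, if_pos (hu.trans huv)]
    gcongr
  · rw [truncPow, if_neg hu]
    exact truncPow_nonneg m v

theorem truncPow_succ (m : ℕ) (u : ℝ) : truncPow (m + 1) u = max u 0 ^ (m + 1) := by
  unfold truncPow
  split_ifs with h
  · rw [max_eq_left h]
  · rw [max_eq_right (not_le.mp h).le]
    simp

theorem continuous_truncPow_succ (m : ℕ) : Continuous (truncPow (m + 1)) := by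
  rw [funext (truncPow_succ m)]
  fun_prop

theorem hasDerivAt_truncPow_succ (m : ℕ) {u : ℝ} (hu : u ≠ 0) :
    HasDerivAt (truncPow (m + 1)) ((m + 1) * truncPow m u) u := by
  rcases hu.lt_or_gt with hu | hu
  · rw [truncPow, if_neg hu.not_ge, mul_zero]
    refine (hasDerivAt_const u (0 : ℝ)).congr_of_eventuallyEq ?_
    filter_upwards [gt_mem_nhds hu] with x hx
    rw [truncPow, if_neg hx.not_ge]
  · rw [truncPow, if_pos hu.le]
    have h := hasDerivAt_pow (m + 1) u
    simp only [Nat.cast_add, Nat.cast_one, Nat.add_sub_cancel] at h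
    refine h.congr_of_eventuallyEq ?_
    filter_upwards [lt_mem_nhds hu] with x hx
    rw [truncPow, if_pos hx.le]

theorem intervalIntegrable_truncPow (m : ℕ) (p q : ℝ) :
    IntervalIntegrable (truncPow m) volume p q :=
  (monotone_truncPow m).intervalIntegrable

theorem integral_truncPow (m : ℕ) (p q : ℝ) :
    ∫ u in p..q, truncPow m u = (truncPow (m + 1) q - truncPow (m + 1) p) / (m + 1) := by
  -- The derivative may fail to exist only at the origin, which the fundamental theorem allows.
  have h := integral_eq_of_hasDerivAt_off_countable (truncPow (m + 1))
    (fun u => (m + 1) * truncPow m u) (a := p) (b := q) (Set.countable_singleton 0)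
    (continuous_truncPow_succ m).continuousOn
    (fun x hx => hasDerivAt_truncPow_succ m (by simpa using hx.2))
    ((intervalIntegrable_truncPow m p q).const_mul _)
  rw [intervalIntegral.integral_const_mul] at h
  rw [← h]
  field_simp

/-! ### Signed sums over vertices -/

/-- The signed sum of truncated powers of degree `m` over the vertices `s` of the cube `[0,1]^n`,
the coordinates of a vertex being encoded as elements of `Fin 2`. -/
noncomputable def vertexSum (m : ℕ) {n : ℕ} (a : Fin n → ℝ) (t : ℝ) : ℝ :=
  ∑ s : Fin n → Fin 2,
    (-1) ^ (∑ i, (s i : ℕ)) * truncPow m (t - ∑ i, a i * ((s i : ℕ) : ℝ))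

/-- Grouping the vertices by their first coordinate turns the signed sum into a difference. -/
theorem vertexSum_succ (m : ℕ) {n : ℕ} (a : Fin (n + 1) → ℝ) (t : ℝ) :
    vertexSum m a t = vertexSum m (Fin.tail a) t - vertexSum m (Fin.tail a) (t - a 0) := by
  unfold vertexSum
  rw [← (Fin.consEquiv fun _ => Fin 2).sum_comp, Fintype.sum_prod_type, Fin.sum_univ_two,
    sub_eq_add_neg, ← Finset.sum_neg_distrib]
  congr 1 <;> refine Finset.sum_congr rfl fun s _ => ?_
  · simp [Fin.consEquiv, Fin.sum_univ_succ, Fin.tail]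
  · simp [Fin.consEquiv, Fin.sum_univ_succ, Fin.tail, pow_add, sub_sub]

theorem integral_vertexSum (m : ℕ) {n : ℕ} (a : Fin n → ℝ) (t : ℝ) {c : ℝ} (hc : c ≠ 0) :
    ∫ x in (0 : ℝ)..1, vertexSum m a (t - c * x) =
      (vertexSum (m + 1) a t - vertexSum (m + 1) a (t - c)) / ((m + 1) * c) := by
  unfold vertexSum
  rw [intervalIntegral.integral_comp_sub_mul (fun u => ∑ s : Fin n → Fin 2,
    (-1) ^ (∑ i, (s i : ℕ)) * truncPow m (u - ∑ i, a i * ((s i : ℕ) : ℝ))) hc,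
    intervalIntegral.integral_finsetSum]
  · simp_rw [intervalIntegral.integral_const_mul,
      intervalIntegral.integral_comp_sub_right (truncPow m), integral_truncPow]
    rw [← Finset.sum_sub_distrib, Finset.smul_sum, Finset.sum_div]
    refine Finset.sum_congr rfl fun s _ => ?_
    simp only [mul_one, mul_zero, sub_zero, smul_eq_mul]
    field_simp
  · intro s _
    refine IntervalIntegrable.const_mul ?_ _
    exact Monotone.intervalIntegrable fun u v huv => monotone_truncPow m (by gcongr)

/-! ### The cube truncated by a half-space -/

/-- The part of the cube `[0,1]^n` that lies in the half-space `a · y ≤ t`. -/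
def cubeHalfspace {n : ℕ} (a : Fin n → ℝ) (t : ℝ) : Set (Fin n → ℝ) :=
  {y | (∀ i, y i ∈ Set.Icc (0 : ℝ) 1) ∧ ∑ i, a i * y i ≤ t}

theorem measurableSet_cubeHalfspace {n : ℕ} (a : Fin n → ℝ) (t : ℝ) :
    MeasurableSet (cubeHalfspace a t) := by
  have hsum : Measurable fun y : Fin n → ℝ => ∑ i, a i * y i := by fun_prop
  have hinter : cubeHalfspace a t =
      (Set.univ.pi fun _ => Set.Icc 0 1) ∩ {y | ∑ i, a i * y i ≤ t} := by
    ext y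
    simp only [cubeHalfspace, Set.mem_ofPred_eq, Set.mem_inter_iff, Set.mem_univ_pi]
  rw [hinter]
  exact (MeasurableSet.univ_pi fun _ => measurableSet_Icc).inter
    (measurableSet_le hsum measurable_const)

theorem volume_ne_top_of_forall_mem_Icc {n : ℕ} {S : Set (Fin n → ℝ)}
    (hS : ∀ y ∈ S, ∀ i, y i ∈ Set.Icc (0 : ℝ) 1) : volume S ≠ ⊤ := by
  have hcube : volume (Set.Icc (0 : Fin n → ℝ) 1) < ⊤ := isCompact_Icc.measure_lt_top
  have hsub : S ⊆ Set.Icc 0 1 := fun y hy => ⟨fun i => (hS y hy i).1, fun i => (hS y hy i).2⟩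
  exact measure_ne_top_of_subset hsub hcube.ne

theorem volume_cubeHalfspace_ne_top {n : ℕ} (a : Fin n → ℝ) (t : ℝ) :
    volume (cubeHalfspace a t) ≠ ⊤ :=
  volume_ne_top_of_forall_mem_Icc fun _ hy => hy.1

/-- Slicing the truncated cube along the first coordinate. -/
theorem volume_real_cubeHalfspace_succ {n : ℕ} (a : Fin (n + 1) → ℝ) (t : ℝ) :
    volume.real (cubeHalfspace a t) =
      ∫ x in (0 : ℝ)..1, volume.real (cubeHalfspace (Fin.tail a) (t - a 0 * x)) := by
  have hpre := (volume_preserving_piFinSuccAbove (fun _ : Fin (n + 1) => ℝ) 0).symm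
    |>.measure_preimage_equiv (cubeHalfspace a t)
  have hmeas : MeasurableSet
      ((MeasurableEquiv.piFinSuccAbove (fun _ : Fin (n + 1) => ℝ) 0).symm ⁻¹' cubeHalfspace a t) :=
    (MeasurableEquiv.measurable _) (measurableSet_cubeHalfspace a t)
  have hslice (x : ℝ) : volume (Prod.mk x ⁻¹'
      ((MeasurableEquiv.piFinSuccAbove (fun _ : Fin (n + 1) => ℝ) 0).symm ⁻¹' cubeHalfspace a t)) =
      (Set.Icc (0 : ℝ) 1).indicator
        (fun x => volume (cubeHalfspace (Fin.tail a) (t - a 0 * x))) x := by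
    by_cases hx : x ∈ Set.Icc (0 : ℝ) 1
    · rw [Set.indicator_of_mem hx]
      congr 1
      ext y
      simp only [Set.mem_preimage, cubeHalfspace, Set.mem_ofPred_eq, Fin.forall_fin_succ,
        Fin.sum_univ_succ, MeasurableEquiv.piFinSuccAbove_symm_apply, Fin.insertNthEquiv_zero,
        Fin.consEquiv_apply, Fin.cons_zero, Fin.cons_succ, hx, true_and, Fin.tail,
        le_sub_iff_add_le']
    · rw [Set.indicator_of_notMem hx]
      convert measure_empty (μ := (volume : Measure (Fin n → ℝ)))
      ext y
      simp only [Set.mem_preimage, cubeHalfspace, Set.mem_ofPred_eq, Fin.forall_fin_succ,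
        MeasurableEquiv.piFinSuccAbove_symm_apply, Fin.insertNthEquiv_zero,
        Fin.consEquiv_apply, Fin.cons_zero, hx, false_and, Set.mem_empty_iff_false]
  have hsm := measurable_measure_prodMk_left (ν := (volume : Measure (Fin n → ℝ))) hmeas
  rw [measureReal_def, ← hpre, Measure.volume_eq_prod, Measure.prod_apply hmeas,
    intervalIntegral.integral_of_le zero_le_one, ← integral_Icc_eq_integral_Ioc,
    ← integral_indicator measurableSet_Icc, ← integral_toReal hsm.aemeasurable]
  · refine integral_congr_ae (.of_forall fun x => ?_)
    simp only [hslice]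
    by_cases hx : x ∈ Set.Icc (0 : ℝ) 1 <;> simp [hx, measureReal_def]
  · refine .of_forall fun x => ?_
    rw [hslice]
    by_cases hx : x ∈ Set.Icc (0 : ℝ) 1
    · rw [Set.indicator_of_mem hx]
      exact (volume_cubeHalfspace_ne_top _ _).lt_top
    · simp [hx]

/-- The formula also covers `n = 0`, where both sides are the indicator of `0 ≤ t`; this is why
`truncPow 0` takes the value `1` at the origin. -/
theorem volume_real_cubeHalfspace {n : ℕ} (a : Fin n → ℝ) (ha : ∀ i, a i ≠ 0) (t : ℝ) :
    volume.real (cubeHalfspace a t) = vertexSum n a t / (n.factorial * ∏ i, a i) := by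
  induction n generalizing t with
  | zero =>
    by_cases ht : 0 ≤ t
    · have : cubeHalfspace a t = Set.univ := by ext; simp [cubeHalfspace, ht]
      simp [this, vertexSum, truncPow, ht, volume_pi, measureReal_def]
    · have : cubeHalfspace a t = ∅ := by ext; simpa [cubeHalfspace] using ht
      simp [this, vertexSum, truncPow, ht]
  | succ n ih =>
    simp_rw [volume_real_cubeHalfspace_succ, ih (Fin.tail a) (fun i => ha i.succ)]
    rw [intervalIntegral.integral_div, integral_vertexSum _ _ _ (ha 0), vertexSum_succ,
      Fin.prod_univ_succ, Nat.factorial_succ, div_div]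
    push_cast
    simp only [Fin.tail]
    congr 1
    ring

/-! ### Parametrization of a hyperplane by its last coordinates -/

/-- The linear part of the parametrization of the hyperplane `a · x = b` by the last `n`
coordinates: it sends `y` to the point `x` of `a · x = 0` whose last `n` coordinates are those
of `y`. -/
noncomputable def graphMap {n : ℕ} (a : EuclideanSpace ℝ (Fin (n + 1))) :
    EuclideanSpace ℝ (Fin n) →ₗ[ℝ] EuclideanSpace ℝ (Fin (n + 1)) where
  toFun y := WithLp.toLp 2 (Fin.cons (-(∑ i, a i.succ * y i) / a 0) fun i => y i)
  map_add' y z := by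
    ext i
    refine Fin.cases ?_ (fun i => ?_) i
    · simp [mul_add, Finset.sum_add_distrib]
      ring
    · simp
  map_smul' c y := by
    ext i
    refine Fin.cases ?_ (fun i => ?_) i
    · simp [mul_left_comm _ c, ← Finset.mul_sum]
      ring
    · simp

@[simp]
theorem graphMap_apply_zero {n : ℕ} (a : EuclideanSpace ℝ (Fin (n + 1)))
    (y : EuclideanSpace ℝ (Fin n)) : graphMap a y 0 = -(∑ i, a i.succ * y i) / a 0 := rfl

@[simp]
theorem graphMap_apply_succ {n : ℕ} (a : EuclideanSpace ℝ (Fin (n + 1)))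
    (y : EuclideanSpace ℝ (Fin n)) (i : Fin n) : graphMap a y i.succ = y i := rfl

/-- The Gram matrix of the parametrization is `1 + u uᵀ` with `u = (a₁, …, aₙ) / a₀`, whose
determinant is `1 + ‖u‖² = ‖a‖² / a₀²`. -/
theorem normDet_graphMap {n : ℕ} (a : EuclideanSpace ℝ (Fin (n + 1))) (ha : a 0 ≠ 0) :
    (graphMap a).normDet = ‖a‖ / |a 0| := by
  have hgram : Matrix.gram ℝ (fun i => graphMap a (EuclideanSpace.basisFun (Fin n) ℝ i)) =
      1 + Matrix.replicateCol Unit (fun i => a (Fin.succ i) / a 0) *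
        Matrix.replicateRow Unit (fun i => a (Fin.succ i) / a 0) := by
    ext i j
    rw [Matrix.gram_apply, PiLp.inner_apply, Fin.sum_univ_succ]
    simp [Matrix.mul_apply, Matrix.one_apply, eq_comm]
    ring
  have hsq : (graphMap a).normDet ^ 2 = (‖a‖ / |a 0|) ^ 2 := by
    have h := (graphMap a).normDet_sq_eq_det_gram (EuclideanSpace.basisFun (Fin n) ℝ)
    rw [hgram, Matrix.det_one_add_replicateCol_mul_replicateRow] at h
    rw [div_pow, sq_abs, EuclideanSpace.real_norm_sq_eq, Fin.sum_univ_succ]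
    refine Eq.trans h ?_
    rw [add_div, div_self (pow_ne_zero 2 ha), Finset.sum_div, dotProduct]
    congr 1
    refine Finset.sum_congr rfl fun i _ => ?_
    ring
  exact (pow_left_inj₀ (LinearMap.normDet_nonneg _) (by positivity) two_ne_zero).mp hsq

/-- The section is a translate of the image under `graphMap a` of its projection, so that its
volume is that of the projection multiplied by the norm determinant of `graphMap a`. -/
theorem volume_section {n : ℕ} (a : EuclideanSpace ℝ (Fin (n + 1))) (ha : a 0 ≠ 0) (b : ℝ) :
    μHE[n] (hyperplane a b ∩ hypercube (n + 1)) = ENNReal.ofReal (‖a‖ / |a 0|) *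
      volume {y : Fin n → ℝ | (∀ i, y i ∈ Set.Icc (0 : ℝ) 1) ∧
        (b - ∑ i, a i.succ * y i) / a 0 ∈ Set.Icc (0 : ℝ) 1} := by
  set S := {y : Fin n → ℝ | (∀ i, y i ∈ Set.Icc (0 : ℝ) 1) ∧
        (b - ∑ i, a i.succ * y i) / a 0 ∈ Set.Icc (0 : ℝ) 1} with hS
  set p : EuclideanSpace ℝ (Fin (n + 1)) := EuclideanSpace.single 0 (b / a 0) with hp
  have himage : hyperplane a b ∩ hypercube (n + 1) =
      p +ᵥ (graphMap a '' ((WithLp.ofLp : EuclideanSpace ℝ (Fin n) → Fin n → ℝ) ⁻¹' S)) := by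
    ext x
    rw [Set.mem_vadd_set]
    constructor
    · rintro ⟨hx, hc⟩
      have hx' : a 0 * x 0 + ∑ i : Fin n, a i.succ * x i.succ = b := by
        rw [← Fin.sum_univ_succ (fun i => a i * x i), ← show inner ℝ a x = b from hx,
          PiLp.inner_apply]
        simp [mul_comm]
      have hx0 : (b - ∑ i : Fin n, a i.succ * x i.succ) / a 0 = x 0 := by
        rw [← hx']
        field_simp
        ring
      refine ⟨_, ⟨WithLp.toLp 2 fun i => x i.succ, ⟨fun i => hc i.succ, ?_⟩, rfl⟩, ?_⟩
      · simpa only [hx0] using hc 0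
      · ext i
        refine Fin.cases ?_ (fun i => ?_) i
        · simp [hp, ← hx0]
          ring
        · simp [hp]
    · rintro ⟨_, ⟨y, ⟨hy, hy0⟩, rfl⟩, rfl⟩
      have h0 : (p +ᵥ graphMap a y) 0 = (b - ∑ i, a i.succ * y i) / a 0 := by
        simp [hp]
        ring
      have hsucc (i : Fin n) : (p +ᵥ graphMap a y) i.succ = y i := by simp [hp]
      refine ⟨?_, fun i => ?_⟩
      · rw [hyperplane, Set.mem_ofPred_eq, PiLp.inner_apply, Fin.sum_univ_succ, h0]
        simp only [hsucc, RCLike.inner_apply, conj_trivial, mul_comm]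
        field_simp
        ring
      · refine Fin.cases ?_ (fun i => ?_) i
        · rw [h0]
          exact hy0
        · rw [hsucc]
          exact hy i
  rw [himage, measure_vadd]
  have h := (graphMap a).euclideanHausdorffMeasure_image_eq_normDet_mul_volume
    ((WithLp.ofLp : EuclideanSpace ℝ (Fin n) → Fin n → ℝ) ⁻¹' S)
  rw [finrank_euclideanSpace_fin, normDet_graphMap a ha] at h
  rw [h]
  congr 1
  exact (EuclideanSpace.volume_preserving_symm_measurableEquiv_toLp (Fin n)).measure_preimage_equiv S

/-! ### Volume of the projected section -/

theorem volume_hyperplane_eq_zero {n : ℕ} (a : Fin n → ℝ) (t : ℝ) {j : Fin n} (hj : a j ≠ 0) :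
    volume {y : Fin n → ℝ | ∑ i, a i * y i = t} = 0 := by
  let s : AffineSubspace ℝ (Fin n → ℝ) :=
    { carrier := {y | ∑ i, a i * y i = t}
      smul_vsub_vadd_mem' := by
        intro c p q r hp hq hr
        simp only [Set.mem_ofPred_eq] at hp hq hr ⊢
        simp [mul_add, mul_sub, mul_left_comm _ c, Finset.sum_add_distrib, ← Finset.mul_sum,
          hp, hq, hr] }
  refine Measure.addHaar_affineSubspace volume s fun hs => ?_
  have h0 : (0 : Fin n → ℝ) ∈ s := hs ▸ AffineSubspace.mem_top ℝ _ _
  have h1 : (Pi.single j 1 : Fin n → ℝ) ∈ s := hs ▸ AffineSubspace.mem_top ℝ _ _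
  have h0' : ∑ i, a i * (0 : Fin n → ℝ) i = t := h0
  have h1' : ∑ i, a i * (Pi.single j 1 : Fin n → ℝ) i = t := h1
  simp [Pi.single_apply] at h0' h1'
  exact hj (h1'.trans h0'.symm)

theorem volume_real_cubeSlab {n : ℕ} (a : Fin n → ℝ) {j : Fin n} (hj : a j ≠ 0) {t t' : ℝ}
    (h : t ≤ t') :
    volume.real {y : Fin n → ℝ | (∀ i, y i ∈ Set.Icc (0 : ℝ) 1) ∧
      t ≤ ∑ i, a i * y i ∧ ∑ i, a i * y i ≤ t'} =
      volume.real (cubeHalfspace a t') - volume.real (cubeHalfspace a t) := by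
  have hsub : cubeHalfspace a t ⊆ cubeHalfspace a t' := fun y hy => ⟨hy.1, hy.2.trans h⟩
  rw [← measureReal_sdiff hsub (measurableSet_cubeHalfspace a t)
    (volume_cubeHalfspace_ne_top a t')]
  -- The closed slab and the difference of the half-spaces differ only inside a hyperplane.
  refine measureReal_congr ?_
  have hnull : ∀ᵐ y : Fin n → ℝ, ∑ i, a i * y i ≠ t :=
    measure_eq_zero_iff_ae_notMem.mp (volume_hyperplane_eq_zero a t hj)
  filter_upwards [hnull] with y hy
  refine propext ⟨fun hs => ⟨⟨hs.1, hs.2.2⟩, fun hs' => hy (le_antisymm hs'.2 hs.2.1)⟩,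
    fun hs => ⟨hs.1.1, ?_, hs.1.2⟩⟩
  exact le_of_not_ge fun hle => hs.2 ⟨hs.1.1, hle⟩

/-- The volume of the projection of the hyperplane section along the first coordinate. The sign
of `a 0` decides which of the two half-spaces contains the other one, and `1 ≤ n` makes the boundary
hyperplane of the slab a null set. -/
theorem volume_real_projection {n : ℕ} (a : Fin (n + 1) → ℝ) (ha : ∀ i, a i ≠ 0) (hn : 1 ≤ n)
    (b : ℝ) :
    volume.real {y : Fin n → ℝ | (∀ i, y i ∈ Set.Icc (0 : ℝ) 1) ∧
        (b - ∑ i, a i.succ * y i) / a 0 ∈ Set.Icc (0 : ℝ) 1} =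
      |a 0| * vertexSum n a b / (n.factorial * ∏ i, a i) := by
  have hj : Fin.tail a ⟨0, hn⟩ ≠ 0 := ha _
  have ha0 := ha 0
  have hprod : ∏ i : Fin n, a i.succ ≠ 0 := Finset.prod_ne_zero_iff.mpr fun i _ => ha _
  have hfac : (n.factorial : ℝ) ≠ 0 := Nat.cast_ne_zero.mpr n.factorial_ne_zero
  rw [vertexSum_succ, Fin.prod_univ_succ]
  rcases (ha 0).lt_or_gt with h | h
  · have hset : {y : Fin n → ℝ | (∀ i, y i ∈ Set.Icc (0 : ℝ) 1) ∧
        (b - ∑ i, a i.succ * y i) / a 0 ∈ Set.Icc (0 : ℝ) 1} =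
        {y | (∀ i, y i ∈ Set.Icc (0 : ℝ) 1) ∧ b ≤ ∑ i, Fin.tail a i * y i ∧
          ∑ i, Fin.tail a i * y i ≤ b - a 0} := by
      ext y
      simp only [Set.mem_ofPred_eq, Set.mem_Icc, le_div_iff_of_neg h, div_le_iff_of_neg h,
        Fin.tail]
      refine and_congr_right fun _ => and_congr ?_ ?_ <;> constructor <;> intro <;> linarith
    rw [hset, volume_real_cubeSlab _ hj (by linarith),
      volume_real_cubeHalfspace (Fin.tail a) fun i => ha i.succ,
      volume_real_cubeHalfspace (Fin.tail a) fun i => ha i.succ, abs_of_neg h]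
    simp only [Fin.tail]
    field_simp
    ring
  · have hset : {y : Fin n → ℝ | (∀ i, y i ∈ Set.Icc (0 : ℝ) 1) ∧
        (b - ∑ i, a i.succ * y i) / a 0 ∈ Set.Icc (0 : ℝ) 1} =
        {y | (∀ i, y i ∈ Set.Icc (0 : ℝ) 1) ∧ b - a 0 ≤ ∑ i, Fin.tail a i * y i ∧
          ∑ i, Fin.tail a i * y i ≤ b} := by
      ext y
      simp only [Set.mem_ofPred_eq, Set.mem_Icc, le_div_iff₀ h, div_le_iff₀ h, Fin.tail]
      refine and_congr_right fun _ => ?_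
      rw [and_comm]
      refine and_congr ?_ ?_ <;> constructor <;> intro <;> linarith
    rw [hset, volume_real_cubeSlab _ hj (by linarith),
      volume_real_cubeHalfspace (Fin.tail a) fun i => ha i.succ,
      volume_real_cubeHalfspace (Fin.tail a) fun i => ha i.succ, abs_of_pos h]
    simp only [Fin.tail]
    field_simp

/-! ### Sums over the vertices of the hypercube -/

/-- A sum over the vertices of the hypercube, reindexed by functions to `Fin 2`. -/
theorem sum_hypercubeVertices {d : ℕ} (f : EuclideanSpace ℝ (Fin d) → ℝ) :
    ∑ v ∈ hypercubeVertices d, f v =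
      ∑ s : Fin d → Fin 2, f (WithLp.toLp 2 fun i => ((s i : ℕ) : ℝ)) := by
  symm
  refine Finset.sum_bij (fun s _ => WithLp.toLp 2 fun i => ((s i : ℕ) : ℝ)) ?_ ?_ ?_ ?_
  · intro s _
    rw [mem_hypercubeVertices]
    intro i
    have h : (s i : ℕ) = 0 ∨ (s i : ℕ) = 1 := by omega
    rcases h with h | h <;> simp [h]
  · intro s _ s' _ h
    ext i
    have := congrArg (fun v : EuclideanSpace ℝ (Fin d) => v i) h
    simpa using this
  · intro v hv
    rw [mem_hypercubeVertices] at hv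
    refine ⟨fun i => if v i = 0 then 0 else 1, Finset.mem_univ _, ?_⟩
    ext i
    rcases hv i with h | h <;> simp [h]
  · intro s _
    rfl

theorem sum_filter_hypercubeVertices {n : ℕ} (a : EuclideanSpace ℝ (Fin (n + 1))) (b : ℝ) :
    ∑ v ∈ (hypercubeVertices (n + 1)).filter (fun v => inner ℝ a v ≤ b),
        (-1 : ℝ) ^ coordSum v * ‖a‖ * (b - inner ℝ a v) ^ n / ((n.factorial : ℝ) * coordProd a) =
      ‖a‖ * vertexSum n a b / (n.factorial * ∏ i, a i) := by
  rw [Finset.sum_filter, sum_hypercubeVertices, vertexSum, Finset.mul_sum, Finset.sum_div]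
  refine Finset.sum_congr rfl fun s _ => ?_
  have hinner : inner ℝ a (WithLp.toLp 2 fun i => ((s i : ℕ) : ℝ)) =
      ∑ i, a i * ((s i : ℕ) : ℝ) := by
    rw [PiLp.inner_apply]
    simp [mul_comm]
  have hsum : coordSum (WithLp.toLp 2 fun i => ((s i : ℕ) : ℝ)) =
      ((∑ i, (s i : ℕ) : ℕ) : ℝ) := by
    simp [coordSum]
  rw [hinner, hsum, Real.rpow_natCast, coordProd, truncPow]
  simp only [sub_nonneg]
  split_ifs
  · ring
  · simp

end HypercubeSection

theorem mainTheorem2 (d : ℕ) (hd : 2 ≤ d) (a : EuclideanSpace ℝ (Fin d)) (ha : ∀ i, a i ≠ 0)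
    (b : ℝ) :
    μHE[d - 1] (HypercubeSection.hyperplane a b ∩ HypercubeSection.hypercube d) ≠ ⊤ ∧
    (μHE[d - 1] (HypercubeSection.hyperplane a b ∩ HypercubeSection.hypercube d)).toReal =
      ∑ v ∈ (HypercubeSection.hypercubeVertices d).filter (fun v => inner ℝ a v ≤ b),
        (-1 : ℝ) ^ HypercubeSection.coordSum v * ‖a‖ * (b - inner ℝ a v) ^ (d - 1) /
          (((d - 1).factorial : ℝ) * HypercubeSection.coordProd a) := by
  obtain ⟨n, rfl⟩ : ∃ n, d = n + 1 := ⟨d - 1, by omega⟩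
  rw [Nat.add_sub_cancel, HypercubeSection.volume_section a (ha 0) b,
    HypercubeSection.sum_filter_hypercubeVertices]
  constructor
  · exact ENNReal.mul_ne_top ENNReal.ofReal_ne_top
      (HypercubeSection.volume_ne_top_of_forall_mem_Icc fun _ hy => hy.1)
  · rw [ENNReal.toReal_mul, ENNReal.toReal_ofReal (by positivity), ← MeasureTheory.measureReal_def,
      HypercubeSection.volume_real_projection a ha (by omega) b]
    have h0 : |a 0| ≠ 0 := abs_ne_zero.mpr (ha 0)
    field_simp
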